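/- Let $p$ be a prime and let $k$ be a field of characteristic $p$. For an integer $t\ge 0$ let $l_p(t)$ be the least nonnegative integer with $t<p^{\,l_p(t)}$. For a partition $\lambda=(\lambda_1\ge\lambda_2\ge\dots\ge\lambda_s\ge 0)$ of $d$ let $S^\lambda$ denote the Specht module over $k$, i.e. the submodule of the permutation module $M^\lambda$ of the symmetric group $\Sigma_d$ on the tabloids of shape $\lambda$ that is spanned by the polytabloids $e_t=\sum_{\pi\in C_t}\operatorname{sgn}(\pi)\,\{\pi t\}$, where $t$ runs over the tableaux of shape $\lambda$ and $C_t$ is the column stabilizer of $t$. Let $\lambda=(\lambda_1,\dots,\lambda_s)\vdash d$ (with $\lambda_1=0$ for the empty partition), and let $a\ge 0$ be an integer with $a\equiv -1 \pmod{p^{\,l_p(\lambda_1)}}$. Then $(a,\lambda_1,\dots,\lambda_s)$ is a partition of $d+a$, and there is an isomorphism of $k$-vector spaces $$H^0(\Sigma_d, S^\lambda)\;\cong\; H^0\bigl(\Sigma_{d+a}, S^{(a,\lambda_1,\dots,\lambda_s)}\bigr).$$ -/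

import Mathlib

open scoped MonoidAlgebra

universe u

namespace SymGrp

/-- `lam = (λ₁, …, λ_s)` is a partition of `d`: a weakly decreasing sequence of nonnegative
integers with sum `d` (as usual, zero parts are harmless and are allowed). -/
def IsPartition (lam : List ℕ) (d : ℕ) : Prop :=
  lam.SortedGE ∧ lam.sum = d

/-- The boxes `(i, j)` of the diagram of `lam`: row `i` has `λ_{i+1}` boxes (rows and columns are
numbered from `0`). -/
def Box (lam : List ℕ) : Type :=
  {c : ℕ × ℕ // c.2 < lam.getD c.1 0}

/-- A tableau of shape `lam`: a bijective filling of the boxes by the `d` entries of `Fin d`. -/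
abbrev Tableau (lam : List ℕ) (d : ℕ) : Type :=
  Box lam ≃ Fin d

/-- The row of the tableau `t` in which the entry `x` stands. -/
def rowOf {lam : List ℕ} {d : ℕ} (t : Tableau lam d) (x : Fin d) : ℕ :=
  (t.symm x).1.1

/-- The column of the tableau `t` in which the entry `x` stands. -/
def colOf {lam : List ℕ} {d : ℕ} (t : Tableau lam d) (x : Fin d) : ℕ :=
  (t.symm x).1.2

/-- The symmetric group acts on tableaux by permuting the entries. -/
instance (lam : List ℕ) (d : ℕ) : MulAction (Equiv.Perm (Fin d)) (Tableau lam d) where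
  smul g t := t.trans g
  one_smul _ := rfl
  mul_smul _ _ _ := rfl

theorem rowOf_smul {lam : List ℕ} {d : ℕ} (g : Equiv.Perm (Fin d)) (t : Tableau lam d)
    (x : Fin d) : rowOf (g • t) x = rowOf t (g⁻¹ x) := rfl

theorem colOf_smul {lam : List ℕ} {d : ℕ} (g : Equiv.Perm (Fin d)) (t : Tableau lam d)
    (x : Fin d) : colOf (g • t) x = colOf t (g⁻¹ x) := rfl

/-- Two tableaux are row equivalent if each entry stands in the same row of both. -/
def rowSetoid (lam : List ℕ) (d : ℕ) : Setoid (Tableau lam d) where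
  r t t' := ∀ x, rowOf t x = rowOf t' x
  iseqv :=
    { refl := fun _ _ => rfl
      symm := fun h x => (h x).symm
      trans := fun h h' x => (h x).trans (h' x) }

/-- A tabloid: a row equivalence class of tableaux. -/
def Tabloid (lam : List ℕ) (d : ℕ) : Type :=
  Quotient (rowSetoid lam d)

/-- The tabloid `{t}` of a tableau `t`. -/
def Tableau.tabloid {lam : List ℕ} {d : ℕ} (t : Tableau lam d) : Tabloid lam d :=
  Quotient.mk (rowSetoid lam d) t

/-- The symmetric group acts on tabloids by `g • {t} = {g • t}`. -/
instance (lam : List ℕ) (d : ℕ) : MulAction (Equiv.Perm (Fin d)) (Tabloid lam d) where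
  smul g := Quotient.map (fun t => g • t) fun _ _ h x => h (g⁻¹ x)
  one_smul T := by induction T using Quotient.inductionOn; rfl
  mul_smul _ _ T := by induction T using Quotient.inductionOn; rfl

theorem smul_tabloid {lam : List ℕ} {d : ℕ} (g : Equiv.Perm (Fin d)) (t : Tableau lam d) :
    g • Tableau.tabloid t = Tableau.tabloid (g • t) := rfl

/-- The column stabilizer of a tableau: the permutations of the entries that preserve each
column. -/
def colStab {lam : List ℕ} {d : ℕ} (t : Tableau lam d) : Finset (Equiv.Perm (Fin d)) :=
  {g | ∀ x, colOf t (g x) = colOf t x}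

theorem mem_colStab {lam : List ℕ} {d : ℕ} {t : Tableau lam d} {g : Equiv.Perm (Fin d)} :
    g ∈ colStab t ↔ ∀ x, colOf t (g x) = colOf t x := by
  simp [colStab]

/-- The permutation representation `M^λ` on the tabloids of shape `lam`. -/
noncomputable abbrev permRep (k : Type u) [Field k] (lam : List ℕ) (d : ℕ) :
    Representation k (Equiv.Perm (Fin d)) k[Tabloid lam d] :=
  Representation.ofMulAction k (Equiv.Perm (Fin d)) (Tabloid lam d)

/-- The polytabloid `e_t`, the sum of `sgn(g) {g t}` over `g` in the column stabilizer of `t`. -/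
noncomputable def polytabloid (k : Type u) [Field k] {lam : List ℕ} {d : ℕ} (t : Tableau lam d) :
    k[Tabloid lam d] :=
  ∑ g ∈ colStab t, MonoidAlgebra.single (g • Tableau.tabloid t) ((Equiv.Perm.sign g : ℤ) : k)

theorem permRep_polytabloid (k : Type u) [Field k] {lam : List ℕ} {d : ℕ}
    (g : Equiv.Perm (Fin d)) (t : Tableau lam d) :
    permRep k lam d g (polytabloid k t) = polytabloid k (g • t) := by
  unfold polytabloid
  rw [map_sum]
  refine Finset.sum_bij (fun h _ => g * h * g⁻¹) ?_ ?_ ?_ ?_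
  · intro h hh
    rw [mem_colStab] at hh ⊢
    intro x
    simp [colOf_smul, hh]
  · intro h _ h' _ e
    simpa using e
  · intro h hh
    refine ⟨g⁻¹ * h * g, ?_, by group⟩
    rw [mem_colStab] at hh ⊢
    intro x
    simpa [colOf_smul] using hh (g x)
  · intro h _
    rw [Representation.ofMulAction_single]
    congr 1
    · simp only [← smul_tabloid, smul_smul]
      congr 1
      group
    · rw [map_mul, map_mul, map_inv, mul_comm, inv_mul_cancel_left]

/-- The Specht module `S^λ` over `k`: the subrepresentation of `M^λ` spanned by the
polytabloids. -/
noncomputable def spechtSub (k : Type u) [Field k] (lam : List ℕ) (d : ℕ) :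
    Subrepresentation (permRep k lam d) where
  toSubmodule := Submodule.span k (Set.range fun t : Tableau lam d => polytabloid k t)
  apply_mem_toSubmodule g v hv := by
    have h : Submodule.span k (Set.range fun t : Tableau lam d => polytabloid k t) ≤
        (Submodule.span k (Set.range fun t : Tableau lam d => polytabloid k t)).comap
          (permRep k lam d g) := by
      rw [Submodule.span_le]
      rintro _ ⟨t, rfl⟩
      exact Submodule.subset_span ⟨g • t, (permRep_polytabloid k g t).symm⟩
    exact h hv

/-- The Specht module `S^λ` as a representation of the symmetric group on `Fin d`. -/
noncomputable abbrev specht (k : Type u) [Field k] (lam : List ℕ) (d : ℕ) :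
    Representation k (Equiv.Perm (Fin d)) (spechtSub k lam d).toSubmodule :=
  (spechtSub k lam d).toRepresentation

/-- Group cohomology `H^n(G, V)` of a representation of a group `G : Type`. Mathlib's
`groupCohomology` wants `G` in the universe of `k`, so `G` is replaced by its isomorphic copy
`ULift G`. -/
noncomputable abbrev cohomology {k : Type u} [Field k] {G : Type} [Group G] {V : Type u}
    [AddCommGroup V] [Module k V] (ρ : Representation k G V) (n : ℕ) : ModuleCat.{u} k :=
  groupCohomology (Rep.of (ρ.comp (MulEquiv.ulift : ULift.{u} G ≃* G).toMonoidHom)) n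

/-- `l_p(t)`: the least nonnegative integer `e` with `t < p ^ e`. -/
noncomputable def lp (p t : ℕ) : ℕ :=
  sInf {e : ℕ | t < p ^ e}

end SymGrp

/-! The symmetric group permutes tabloids transitively, so the invariants of `permRep` are the
multiples of the sum f of all tabloids. Hence H⁰ of a Specht module has dimension 1 or 0, according
to whether f lies in it, and `tabloidSum_mem_iff` decides this: f ∈ S^λ iff C(λ_i + 1, q) = 0 in k
for all i and all 1 ≤ q ≤ λ_{i+1}.

By duality, f ∈ S^λ iff every function on tabloids orthogonal to the polytabloids has total sum 0.
Indicators of Garnir sets with more than λ_i entries are such functions (`isOrthogonal_garnirFun`),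
and for λ_i + 1 entries their sums are the binomials above; this gives necessity. For sufficiency,
Garnir functions clear an orthogonal function from the smallest tabloid upwards without changing its
sum; at tabloids of standard tableaux, orthogonality to the polytabloid does the clearing
(`standard_or_garnir`, `sum_eq_zero_of_isOrthogonal`).

A new first row a adds only the conditions C(a + 1, q) = 0 for 1 ≤ q ≤ λ₁. They hold because p^l
divides a + 1 and q < p^l, so the criterion is the same for both partitions (`binomVanish_cons`). -/

namespace SymGrp

open Finset

variable {lam : List ℕ} {d : ℕ}

/-! ### Tabloids as row functions -/

/-- The boxes of a diagram, listed row by row. -/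
def boxEquivSigma (lam : List ℕ) : Box lam ≃ Σ i : Fin lam.length, Fin (lam.get i) where
  toFun c :=
    have h : c.1.1 < lam.length := by
      by_contra hc
      have := c.2
      rw [List.getD_eq_default _ _ (not_lt.1 hc)] at this
      exact absurd this (Nat.not_lt_zero _)
    ⟨⟨c.1.1, h⟩, ⟨c.1.2, by simpa [h] using c.2⟩⟩
  invFun s := ⟨(s.1, s.2), by simp⟩
  left_inv _ := rfl
  right_inv _ := rfl

instance (lam : List ℕ) : Finite (Box lam) := Finite.of_equiv _ (boxEquivSigma lam).symm

theorem card_box (lam : List ℕ) : Nat.card (Box lam) = lam.sum := by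
  rw [Nat.card_congr (boxEquivSigma lam), Nat.card_sigma]
  simp [Fin.sum_univ_getElem]

instance (lam : List ℕ) (d : ℕ) : Finite (Tabloid lam d) := Quotient.finite _

noncomputable instance (lam : List ℕ) (d : ℕ) : Fintype (Tabloid lam d) := Fintype.ofFinite _

namespace Tabloid

/-- The row of the tabloid `T` in which the entry `x` stands. -/
def row (T : Tabloid lam d) (x : Fin d) : ℕ :=
  Quotient.lift (fun t : Tableau lam d => rowOf t x) (fun a b (h : ∀ y, rowOf a y = rowOf b y) => h x) T

theorem row_tabloid (t : Tableau lam d) (x : Fin d) : row t.tabloid x = rowOf t x := rfl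

theorem exists_tableau (T : Tabloid lam d) : ∃ t : Tableau lam d, t.tabloid = T :=
  Quotient.exists_rep T

theorem row_smul (g : Equiv.Perm (Fin d)) (T : Tabloid lam d) (x : Fin d) :
    row (g • T) x = row T (g⁻¹ x) := by
  obtain ⟨t, rfl⟩ := T.exists_tableau
  rfl

theorem row_injective : Function.Injective (row : Tabloid lam d → Fin d → ℕ) := by
  intro T T' h
  obtain ⟨t, rfl⟩ := T.exists_tableau
  obtain ⟨t', rfl⟩ := T'.exists_tableau
  exact Quotient.sound fun x => congrFun h x

theorem card_row (T : Tabloid lam d) (i : ℕ) : #{x | T.row x = i} = lam.getD i 0 := by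
  obtain ⟨t, rfl⟩ := T.exists_tableau
  rw [← card_range (lam.getD i 0)]
  symm
  refine card_bij (fun j hj => t ⟨(i, j), mem_range.1 hj⟩) ?_ ?_ ?_
  · intro j hj
    refine mem_filter.2 ⟨mem_univ _, ?_⟩
    exact congrArg (fun c : Box lam => c.1.1) (t.symm_apply_apply _)
  · intro j hj j' hj' h
    simpa using congrArg (fun c : Box lam => c.1.2) (t.injective h)
  · intro x hx
    have hx : (t.symm x).1.1 = i := (mem_filter.1 hx).2
    have h2 := (t.symm x).2
    refine ⟨(t.symm x).1.2, by rw [mem_range, ← hx]; exact h2, ?_⟩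
    subst hx
    exact t.apply_symm_apply x

/-- The symmetric group acts transitively on tabloids. -/
theorem exists_smul_eq (T T' : Tabloid lam d) : ∃ g : Equiv.Perm (Fin d), g • T = T' := by
  obtain ⟨t, rfl⟩ := T.exists_tableau
  obtain ⟨t', rfl⟩ := T'.exists_tableau
  refine ⟨t.symm.trans t', ?_⟩
  rw [smul_tabloid]
  congr 1
  exact Equiv.ext fun c => congrArg t' (t.symm_apply_apply c)

end Tabloid

/-- A filling of the rows with the right number of entries in each row comes from a tableau whose
rows increase. -/
theorem exists_tableau_of_card_row (hd : lam.sum = d) (r : Fin d → ℕ)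
    (hr : ∀ i, #{x | r x = i} = lam.getD i 0) :
    ∃ t : Tableau lam d, (∀ x, rowOf t x = r x) ∧
      ∀ x, colOf t x = #{y | y < x ∧ r y = r x} := by
  have hlt : ∀ x, #{y | y < x ∧ r y = r x} < lam.getD (r x) 0 := by
    intro x
    rw [← hr]
    refine card_lt_card ⟨fun y hy => ?_, fun h => ?_⟩
    · simp only [mem_filter, mem_univ, true_and] at hy ⊢
      exact hy.2
    · have := h (show x ∈ ({y | r y = r x} : Finset (Fin d)) by simp)
      simp at this
  -- Listing each row in increasing order: the column of x counts the smaller entries of its row.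
  let f : Fin d → Box lam := fun x => ⟨(r x, #{y | y < x ∧ r y = r x}), hlt x⟩
  have hf : Function.Injective f := by
    have key : ∀ x y, x < y → f x ≠ f y := by
      intro x y hxy h
      have h1 : r x = r y := congrArg (fun c : Box lam => c.1.1) h
      have h2 : #{z | z < x ∧ r z = r x} = #{z | z < y ∧ r z = r y} :=
        congrArg (fun c : Box lam => c.1.2) h
      refine absurd h2 (ne_of_lt (card_lt_card ⟨fun z hz => ?_, fun h => ?_⟩))
      · simp only [mem_filter, mem_univ, true_and] at hz ⊢
        exact ⟨hz.1.trans hxy, hz.2.trans h1⟩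
      · have := h (show x ∈ ({z | z < y ∧ r z = r y} : Finset (Fin d)) by simp [hxy, h1])
        simp at this
    intro x y h
    rcases lt_trichotomy x y with hlt | rfl | hlt
    · exact absurd h (key _ _ hlt)
    · rfl
    · exact absurd h.symm (key _ _ hlt)
  have hbij : Function.Bijective f :=
    (Nat.bijective_iff_injective_and_card f).2 ⟨hf, by rw [card_box, hd]; simp⟩
  refine ⟨(Equiv.ofBijective f hbij).symm, fun x => ?_, fun x => ?_⟩
  · rfl
  · rfl

theorem exists_tabloid_of_card_row (hd : lam.sum = d) (r : Fin d → ℕ)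
    (hr : ∀ i, #{x | r x = i} = lam.getD i 0) : ∃ T : Tabloid lam d, T.row = r := by
  obtain ⟨t, ht, -⟩ := exists_tableau_of_card_row hd r hr
  exact ⟨t.tabloid, funext ht⟩

theorem nonempty_tabloid (hd : lam.sum = d) : Nonempty (Tabloid lam d) := by
  have : Nat.card (Box lam) = Nat.card (Fin d) := by rw [card_box, hd]; simp
  exact ⟨Tableau.tabloid (Classical.choice ((Finite.card_eq).1 this))⟩

/-! ### Garnir sets and their size -/

open Classical in
/-- The tabloids that agree with `T` outside `U` and have the entries of `U` in the rows
`i` and `i + 1`. -/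
noncomputable def garnirSet (T : Tabloid lam d) (i : ℕ) (U : Finset (Fin d)) :
    Finset (Tabloid lam d) :=
  {T' | (∀ x ∉ U, T'.row x = T.row x) ∧ ∀ x ∈ U, T'.row x = i ∨ T'.row x = i + 1}

theorem mem_garnirSet {T T' : Tabloid lam d} {i : ℕ} {U : Finset (Fin d)} :
    T' ∈ garnirSet T i U ↔
      (∀ x ∉ U, T'.row x = T.row x) ∧ ∀ x ∈ U, T'.row x = i ∨ T'.row x = i + 1 := by
  simp [garnirSet]

theorem card_filter_add_card_filter_notMem (r : Fin d → ℕ) (U : Finset (Fin d)) (j : ℕ) :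
    #{x | r x = j} = #{x ∈ U | r x = j} + #{x | x ∉ U ∧ r x = j} := by
  rw [← card_union_of_disjoint]
  · congr 1
    ext x
    simp only [mem_filter, mem_union, mem_univ, true_and]
    tauto
  · rw [disjoint_left]
    intro x
    simp only [mem_filter, mem_univ, true_and]
    tauto

/-- The shape fixes the total count in each row, and the two tabloids agree outside U. -/
theorem card_filter_eq_of_mem_garnirSet {T T' : Tabloid lam d} {i : ℕ} {U : Finset (Fin d)}
    (h : T' ∈ garnirSet T i U) (j : ℕ) : #{x ∈ U | T'.row x = j} = #{x ∈ U | T.row x = j} := by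
  have h1 := card_filter_add_card_filter_notMem T.row U j
  have h2 := card_filter_add_card_filter_notMem T'.row U j
  have h3 : ({x | x ∉ U ∧ T'.row x = j} : Finset (Fin d)) =
      ({x | x ∉ U ∧ T.row x = j} : Finset (Fin d)) := by
    refine filter_congr fun x _ => and_congr_right fun hx => ?_
    rw [(mem_garnirSet.1 h).1 x hx]
  rw [Tabloid.card_row] at h1 h2
  rw [h3] at h2
  omega

theorem card_garnirSet (hd : lam.sum = d) {T : Tabloid lam d} {i : ℕ} {U : Finset (Fin d)}
    (hU : ∀ x ∈ U, T.row x = i ∨ T.row x = i + 1) :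
    #(garnirSet T i U) = (#U).choose #{x ∈ U | T.row x = i + 1} := by
  have split : ∀ r : Fin d → ℕ, (∀ x ∈ U, r x = i ∨ r x = i + 1) →
      #{x ∈ U | r x = i} + #{x ∈ U | r x = i + 1} = #U := by
    intro r hr
    rw [← card_filter_add_card_filter_not (s := U) (fun x => r x = i)]
    congr 2
    refine filter_congr fun x hx => ?_
    have := hr x hx
    omega
  -- A member of the Garnir set is determined by which entries of U it puts in row i + 1, and any
  -- choice of the right size occurs.
  rw [← card_powersetCard]
  refine card_bij (fun T' _ => {x ∈ U | T'.row x = i + 1}) ?_ ?_ ?_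
  · intro T' h
    exact mem_powersetCard.2 ⟨filter_subset _ _, card_filter_eq_of_mem_garnirSet h _⟩
  · intro T' h T'' h' e
    rw [mem_garnirSet] at h h'
    refine Tabloid.row_injective (funext fun x => ?_)
    by_cases hx : x ∈ U
    · have := congrArg (x ∈ ·) e
      simp only [mem_filter, hx, true_and, eq_iff_iff] at this
      have h1 := h.2 x hx
      have h2 := h'.2 x hx
      omega
    · rw [h.1 x hx, h'.1 x hx]
  · intro C hC
    rw [mem_powersetCard] at hC
    let r : Fin d → ℕ := fun x => if x ∈ U then if x ∈ C then i + 1 else i else T.row x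
    have hrU : ∀ x ∈ U, r x = i ∨ r x = i + 1 := by
      intro x hx
      simp only [r, hx, if_true]
      split_ifs <;> simp
    have hrC : ({x ∈ U | r x = i + 1} : Finset (Fin d)) = C := by
      ext x
      simp only [mem_filter, r]
      constructor
      · rintro ⟨hx, h⟩
        by_contra hc
        simp [hx, hc] at h
      · intro hx
        simp [hC.1 hx, hx]
    have hr' : ∀ x ∉ U, r x = T.row x := fun x hx => by simp [r, hx]
    obtain ⟨T', hT'⟩ := exists_tabloid_of_card_row hd r (fun j => by
      rw [← T.card_row j, card_filter_add_card_filter_notMem r U,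
        card_filter_add_card_filter_notMem T.row U]
      have h3 : ({x | x ∉ U ∧ r x = j} : Finset (Fin d)) =
          ({x | x ∉ U ∧ T.row x = j} : Finset (Fin d)) := by
        refine filter_congr fun x _ => and_congr_right fun hx => ?_
        rw [hr' x hx]
      rw [h3]
      congr 1
      have s1 := split r hrU
      have s2 := split T.row hU
      rw [hrC] at s1
      by_cases h1 : j = i + 1
      · rw [h1, hrC, hC.2]
      · by_cases h0 : j = i
        · rw [h0]; omega
        · rw [filter_false_of_mem, filter_false_of_mem]
          · intro x hx; have := hU x hx; omega
          · intro x hx; have := hrU x hx; omega)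
    refine ⟨T', ?_, ?_⟩
    · rw [mem_garnirSet, hT']
      exact ⟨hr', hrU⟩
    · simp only [hT']
      exact hrC

variable {k : Type u} [Field k]

theorem getD_succ_le (hlam : lam.SortedGE) (i : ℕ) : lam.getD (i + 1) 0 ≤ lam.getD i 0 := by
  by_cases h : i + 1 < lam.length
  · rw [List.getD_eq_getElem _ _ h, List.getD_eq_getElem _ _ (by omega)]
    exact hlam.getElem_ge_getElem_of_le (by omega)
  · rw [List.getD_eq_default _ _ (not_lt.1 h)]
    exact Nat.zero_le _

theorem colOf_lt (t : Tableau lam d) (x : Fin d) : colOf t x < lam.getD (rowOf t x) 0 :=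
  (t.symm x).2

theorem eq_of_rowOf_eq_of_colOf_eq (t : Tableau lam d) {x y : Fin d} (hr : rowOf t x = rowOf t y)
    (hc : colOf t x = colOf t y) : x = y :=
  t.symm.injective (Subtype.ext (Prod.ext hr hc))

theorem exists_rowOf_colOf (t : Tableau lam d) {i j : ℕ} (h : j < lam.getD i 0) :
    ∃ x, rowOf t x = i ∧ colOf t x = j := by
  refine ⟨t ⟨(i, j), h⟩, ?_, ?_⟩
  · exact congrArg (fun c : Box lam => c.1.1) (t.symm_apply_apply _)
  · exact congrArg (fun c : Box lam => c.1.2) (t.symm_apply_apply _)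

theorem colOf_inv_apply {t : Tableau lam d} {g : Equiv.Perm (Fin d)} (hg : g ∈ colStab t)
    (x : Fin d) : colOf t (g⁻¹ x) = colOf t x := by
  simpa using (mem_colStab.1 hg (g⁻¹ x)).symm

/-! ### Functions orthogonal to the Specht module -/

/-- The functions on tabloids that are orthogonal to all polytabloids. -/
def IsOrthogonal (v : Tabloid lam d → k) : Prop :=
  ∀ t : Tableau lam d,
    ∑ g ∈ colStab t, ((Equiv.Perm.sign g : ℤ) : k) * v (g • Tableau.tabloid t) = 0

open Classical in
/-- The indicator function of `garnirSet T i U`. -/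
noncomputable def garnirFun (k : Type u) [Field k] (T : Tabloid lam d) (i : ℕ)
    (U : Finset (Fin d)) (T' : Tabloid lam d) : k :=
  if T' ∈ garnirSet T i U then 1 else 0

theorem swap_smul_mem_garnirSet {T T' : Tabloid lam d} {i : ℕ} {U : Finset (Fin d)} {x y : Fin d}
    (hx : x ∈ U) (hy : y ∈ U) (h : T' ∈ garnirSet T i U) :
    Equiv.swap x y • T' ∈ garnirSet T i U := by
  rw [mem_garnirSet] at h ⊢
  simp only [Tabloid.row_smul, Equiv.swap_inv]
  refine ⟨fun z hz => ?_, fun z hz => h.2 _ ?_⟩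
  · rw [Equiv.swap_apply_of_ne_of_ne (ne_of_mem_of_not_mem hx hz).symm
      (ne_of_mem_of_not_mem hy hz).symm]
    exact h.1 z hz
  · rw [Equiv.swap_apply_def]
    split_ifs <;> assumption

theorem garnirFun_swap_smul (T T' : Tabloid lam d) (i : ℕ) {U : Finset (Fin d)} {x y : Fin d}
    (hx : x ∈ U) (hy : y ∈ U) :
    garnirFun k T i U (Equiv.swap x y • T') = garnirFun k T i U T' := by
  have : Equiv.swap x y • T' ∈ garnirSet T i U ↔ T' ∈ garnirSet T i U :=
    ⟨fun h => by simpa [smul_smul] using swap_smul_mem_garnirSet hx hy h,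
      swap_smul_mem_garnirSet hx hy⟩
  classical exact if_congr this rfl rfl

/-- Pigeonhole forces two entries of U into one column of t; swapping them reverses signs and
preserves the Garnir set, so the terms cancel in pairs. -/
theorem isOrthogonal_garnirFun (hlam : lam.SortedGE) (T : Tabloid lam d) {i : ℕ}
    {U : Finset (Fin d)} (hU : lam.getD i 0 < #U) : IsOrthogonal (garnirFun k T i U) := by
  intro t
  by_cases h : ∃ g ∈ colStab t, g • Tableau.tabloid t ∈ garnirSet T i U
  · obtain ⟨g₀, hg₀, hm⟩ := h
    -- `g₀` preserves columns and puts U into rows i and i + 1, neither longer than λ_i, so U meets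
    -- at most λ_i columns of t.
    have hcol : ∀ x ∈ U, colOf t x ∈ range (lam.getD i 0) := by
      intro x hx
      rw [mem_range, ← colOf_inv_apply hg₀]
      have h1 := (mem_garnirSet.1 hm).2 x hx
      rw [Tabloid.row_smul, Tabloid.row_tabloid] at h1
      have h2 := colOf_lt t (g₀⁻¹ x)
      rcases h1 with h1 | h1 <;> rw [h1] at h2
      · exact h2
      · exact h2.trans_le (getD_succ_le hlam i)
    obtain ⟨x, hx, y, hy, hne, hxy⟩ :=
      exists_ne_map_eq_of_card_lt_of_maps_to (by rwa [card_range]) hcol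
    refine sum_involution (fun g _ => Equiv.swap x y * g) ?_ ?_ ?_ ?_
    · intro g _
      rw [mul_smul, garnirFun_swap_smul _ _ _ hx hy, map_mul, Equiv.Perm.sign_swap hne]
      simp
    · intro g _ _ h
      exact hne (Equiv.swap_eq_one_iff.1 (mul_eq_right.1 h))
    · intro g hg
      rw [mem_colStab] at hg ⊢
      intro z
      rw [Equiv.Perm.mul_apply, ← hg z, Equiv.swap_apply_def]
      split_ifs with h1 h2
      · rw [h1, hxy]
      · rw [h2, hxy]
      · rfl
    · intro g _
      simp [← mul_assoc]
  · push Not at h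
    exact sum_eq_zero fun g hg => by simp [garnirFun, h g hg]

/-! ### Order on tabloids, standard tableaux and Garnir relations -/

namespace Tabloid

/-- Tabloids are ordered by comparing the rows of the largest entry that stands in different
rows. -/
noncomputable instance : LinearOrder (Tabloid lam d) :=
  LinearOrder.lift' (fun T => toColex T.row) fun _ _ h => row_injective (toColex_inj.1 h)

theorem lt_iff {T T' : Tabloid lam d} :
    T < T' ↔ ∃ x, (∀ y, x < y → T.row y = T'.row y) ∧ T.row x < T'.row x := Iff.rfl

theorem exists_last_row_ne {T T' : Tabloid lam d} (h : T ≠ T') :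
    ∃ x, T.row x ≠ T'.row x ∧ ∀ y, x < y → T.row y = T'.row y := by
  have hne : ({x | T.row x ≠ T'.row x} : Finset (Fin d)).Nonempty := by
    by_contra hc
    rw [not_nonempty_iff_eq_empty, filter_eq_empty_iff] at hc
    exact h (row_injective (funext fun x => by simpa using hc (mem_univ x)))
  refine ⟨_, (mem_filter.1 (max'_mem _ hne)).2, fun y hy => ?_⟩
  by_contra hc
  exact absurd hy (not_lt.2 (le_max' _ y (by simpa using hc)))

end Tabloid

/-- If the columns of `t` increase, then `{t}` is the largest tabloid occurring in its
polytabloid. -/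
theorem smul_tabloid_lt {t : Tableau lam d}
    (ht : ∀ x y, colOf t x = colOf t y → rowOf t x < rowOf t y → x < y)
    {g : Equiv.Perm (Fin d)} (hg : g ∈ colStab t) (hg1 : g ≠ 1) :
    g • Tableau.tabloid t < Tableau.tabloid t := by
  have hfix : ∀ x, rowOf t (g⁻¹ x) = rowOf t x → g⁻¹ x = x := fun x h =>
    eq_of_rowOf_eq_of_colOf_eq t h (colOf_inv_apply hg x)
  have hne : g • Tableau.tabloid t ≠ Tableau.tabloid t := by
    intro h
    refine hg1 (inv_eq_one.1 (Equiv.ext fun x => hfix x ?_))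
    have := congrArg (fun T => T.row x) h
    rwa [Tabloid.row_smul] at this
  obtain ⟨x, hx, hmax⟩ := Tabloid.exists_last_row_ne hne
  refine Tabloid.lt_iff.2 ⟨x, hmax, ?_⟩
  simp only [Tabloid.row_smul, Tabloid.row_tabloid] at hx hmax ⊢
  -- Entries above x keep their row and column, so `g⁻¹` fixes them and cannot send x to one of
  -- them.
  have hle : g⁻¹ x < x := by
    rcases lt_trichotomy (g⁻¹ x) x with h | h | h
    · exact h
    · exact absurd (by rw [h]) hx
    · exact absurd (g⁻¹.injective (hfix _ (hmax _ h))) h.ne'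
  refine lt_of_le_of_ne (not_lt.1 fun h => ?_) hx
  exact absurd (ht _ _ (colOf_inv_apply hg x).symm h) hle.asymm

theorem columns_increase_of_adjacent (hlam : lam.SortedGE) {t : Tableau lam d}
    (ht : ∀ a b, colOf t a = colOf t b → rowOf t b = rowOf t a + 1 → a < b) :
    ∀ x y, colOf t x = colOf t y → rowOf t x < rowOf t y → x < y := by
  suffices ∀ n x y, rowOf t y = n → colOf t x = colOf t y → rowOf t x < n → x < y from
    fun x y hc hr => this _ x y rfl hc hr
  intro n
  induction n with
  | zero => intro x y _ _ h; omega
  | succ n ih =>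
    intro x y hy hc hr
    by_cases hx : rowOf t x = n
    · exact ht x y hc (by omega)
    · have h1 := colOf_lt t y
      rw [hy] at h1
      obtain ⟨z, hz, hzc⟩ := exists_rowOf_colOf t (h1.trans_le (getD_succ_le hlam n))
      exact (ih x z hz (by omega) (by omega)).trans (ht z y hzc (by omega))

/-- If in `T` the entries of `U` in row `i + 1` are smaller than those in row `i`, then `T` is the
smallest tabloid in its Garnir set. -/
theorem lt_of_mem_garnirSet {T T' : Tabloid lam d} {i : ℕ} {U : Finset (Fin d)}
    (hU : ∀ x ∈ U, T.row x = i ∨ T.row x = i + 1)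
    (hlt : ∀ x ∈ U, ∀ y ∈ U, T.row x = i + 1 → T.row y = i → x < y)
    (hT' : T' ∈ garnirSet T i U) (hne : T' ≠ T) : T < T' := by
  obtain ⟨x, hx, hmax⟩ := Tabloid.exists_last_row_ne hne.symm
  refine Tabloid.lt_iff.2 ⟨x, hmax, ?_⟩
  have hm := mem_garnirSet.1 hT'
  have hxU : x ∈ U := by
    by_contra hc
    exact hx (hm.1 x hc).symm
  have h1 := hU x hxU
  have h2 := hm.2 x hxU
  by_contra hc
  have hxi : T.row x = i + 1 ∧ T'.row x = i := by omega
  -- Entries of U in row i of T exceed x, so they stay there in T'. With x moved up to row i, row i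
  -- + 1 has lost an entry of U and gained none.
  refine absurd (card_filter_eq_of_mem_garnirSet hT' (i + 1)) (card_lt_card ⟨?_, ?_⟩).ne
  · intro z hz
    simp only [mem_filter] at hz ⊢
    refine ⟨hz.1, ?_⟩
    by_contra hzi
    have h3 : T.row z = i := (hU z hz.1).resolve_right hzi
    have h4 := hmax z (hlt x hxU z hz.1 hxi.1 h3)
    omega
  · intro h
    have := (mem_filter.1 (h (mem_filter.2 ⟨hxU, hxi.1⟩))).2
    omega

/-- A tabloid either comes from a standard tableau, or is the smallest tabloid in a Garnir
relation. -/
theorem standard_or_garnir (hlam : lam.SortedGE) (hd : lam.sum = d) (T : Tabloid lam d) :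
    (∃ t : Tableau lam d, t.tabloid = T ∧
      ∀ x y, colOf t x = colOf t y → rowOf t x < rowOf t y → x < y) ∨
    ∃ (i : ℕ) (U : Finset (Fin d)), (∀ x ∈ U, T.row x = i ∨ T.row x = i + 1) ∧
      #U = lam.getD i 0 + 1 ∧ 1 ≤ #{x ∈ U | T.row x = i + 1} ∧
      ∀ T' ∈ garnirSet T i U, T' ≠ T → T < T' := by
  obtain ⟨t, htr, htc⟩ := exists_tableau_of_card_row hd T.row T.card_row
  have htT : t.tabloid = T := Tabloid.row_injective (funext htr)
  by_cases hstd : ∀ a b, colOf t a = colOf t b → rowOf t b = rowOf t a + 1 → a < b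
  · exact Or.inl ⟨t, htT, columns_increase_of_adjacent hlam hstd⟩
  · right
    push Not at hstd
    obtain ⟨a, b, hc, hr, hba⟩ := hstd
    have hba : b < a := lt_of_le_of_ne hba (by rintro rfl; omega)
    rw [htc, htc] at hc
    rw [htr, htr] at hr
    -- The descent b < a, with b directly below a in column c, gives the Garnir set: c + 1 entries
    -- of row i + 1 up to b, and λ_i − c entries of row i from a on.
    let i := T.row a
    let B : Finset (Fin d) := {x | x ≤ b ∧ T.row x = i + 1}
    let A : Finset (Fin d) := {x | a ≤ x ∧ T.row x = i}
    have hB : ∀ {x}, x ∈ B ↔ x ≤ b ∧ T.row x = i + 1 := by simp [B]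
    have hA : ∀ {x}, x ∈ A ↔ a ≤ x ∧ T.row x = i := by simp [A]
    have hU : ∀ x ∈ B ∪ A, T.row x = i ∨ T.row x = i + 1 := by
      intro x hx
      rcases mem_union.1 hx with h | h
      · exact Or.inr (hB.1 h).2
      · exact Or.inl (hA.1 h).2
    have hdisj : Disjoint B A := disjoint_left.2 fun x h h' => by
      have := (hB.1 h).2
      have := (hA.1 h').2
      omega
    have hBcard : #B = #{y | y < b ∧ T.row y = T.row b} + 1 := by
      rw [← card_insert_of_notMem (a := b) (by simp)]
      congr 1
      ext x
      simp only [hB, mem_insert, mem_filter, mem_univ, true_and, le_iff_lt_or_eq, hr, i]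
      constructor
      · rintro ⟨h | h, h'⟩
        · exact Or.inr ⟨h, h'⟩
        · exact Or.inl h
      · rintro (rfl | h)
        · exact ⟨Or.inr rfl, hr⟩
        · exact ⟨Or.inl h.1, h.2⟩
    have hAcard : #{y | y < a ∧ T.row y = T.row a} + #A = lam.getD i 0 := by
      rw [← T.card_row i, ← card_union_of_disjoint]
      · congr 1
        ext x
        simp only [hA, mem_union, mem_filter, mem_univ, true_and, i, ← or_and_right, lt_or_ge]
      · rw [disjoint_left]
        intro x h h'
        exact absurd (hA.1 h').1 (not_le.2 (mem_filter.1 h).2.1)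
    have hfil : ({x ∈ B ∪ A | T.row x = i + 1} : Finset (Fin d)) = B := by
      ext x
      simp only [mem_filter, mem_union, hA, hB]
      constructor
      · rintro ⟨h | h, h'⟩
        · exact h
        · omega
      · exact fun h => ⟨Or.inl h, h.2⟩
    refine ⟨i, B ∪ A, hU, ?_, ?_, ?_⟩
    · rw [card_union_of_disjoint hdisj]
      omega
    · rw [hfil]
      omega
    · intro T' hT' hne
      refine lt_of_mem_garnirSet hU ?_ hT' hne
      intro x hx y hy hxi hyi
      have hx' : x ≤ b := by
        rcases mem_union.1 hx with h | h
        · exact (hB.1 h).1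
        · have := (hA.1 h).2; omega
      have hy' : a ≤ y := by
        rcases mem_union.1 hy with h | h
        · have := (hB.1 h).2; omega
        · exact (hA.1 h).1
      exact hx'.trans_lt (hba.trans_le hy')

theorem card_filter_row_le (T : Tabloid lam d) (U : Finset (Fin d)) (i : ℕ) :
    #{x ∈ U | T.row x = i} ≤ lam.getD i 0 := by
  rw [← T.card_row i]
  exact card_le_card (filter_subset_filter _ (subset_univ _))

theorem sum_garnirFun (T : Tabloid lam d) (i : ℕ) (U : Finset (Fin d)) :
    ∑ T', garnirFun k T i U T' = (#(garnirSet T i U) : k) := by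
  simp [garnirFun]

/-! ### The criterion for the sum of all tabloids -/

/-- The binomial coefficients that decide whether the Specht module has an invariant vanish. -/
def BinomVanish (k : Type u) [Field k] (lam : List ℕ) : Prop :=
  ∀ i q, 1 ≤ q → q ≤ lam.getD (i + 1) 0 → (((lam.getD i 0 + 1).choose q : ℕ) : k) = 0

theorem sum_eq_zero_of_isOrthogonal (hlam : lam.SortedGE) (hd : lam.sum = d)
    (hb : BinomVanish k lam) {v : Tabloid lam d → k} (hv : IsOrthogonal v) : ∑ T, v T = 0 := by
  -- Induction moves T₀ upwards: v already vanishes below T₀, and each step makes it vanish at T₀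
  -- too, keeping its sum.
  suffices main : ∀ T₀ : Tabloid lam d, ∀ v : Tabloid lam d → k, IsOrthogonal v →
      (∀ T < T₀, v T = 0) → ∑ T, v T = 0 by
    have := nonempty_tabloid hd
    obtain ⟨T₀, -, h⟩ := exists_min_image (univ : Finset (Tabloid lam d)) id univ_nonempty
    exact main T₀ v hv fun T hT => absurd (h T (mem_univ T)) (not_le.2 hT)
  intro T₀
  induction T₀ using WellFoundedGT.induction with
  | ind T₀ ih =>
  intro v hv hlow
  obtain ⟨w, hw, hwlow, hsum⟩ : ∃ w : Tabloid lam d → k, IsOrthogonal w ∧ (∀ T ≤ T₀, w T = 0) ∧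
      ∑ T, v T = ∑ T, w T := by
    rcases standard_or_garnir hlam hd T₀ with ⟨t, rfl, ht⟩ | ⟨i, U, hU, hcard, hq, hmin⟩
    · refine ⟨v, hv, fun T hT => ?_, rfl⟩
      rcases hT.lt_or_eq with hT | rfl
      · exact hlow T hT
      · have h := hv t
        rw [sum_eq_single_of_mem 1 (mem_colStab.2 fun _ => rfl)] at h
        · simpa using h
        · intro g hg hg1
          rw [hlow _ (smul_tabloid_lt ht hg hg1), mul_zero]
    · have hg : ∑ T', garnirFun k T₀ i U T' = 0 := by
        rw [sum_garnirFun, card_garnirSet hd hU, hcard]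
        exact hb i _ hq (card_filter_row_le _ _ _)
      have hself : garnirFun k T₀ i U T₀ = 1 :=
        if_pos (mem_garnirSet.2 ⟨fun _ _ => rfl, hU⟩)
      refine ⟨fun T => v T - v T₀ * garnirFun k T₀ i U T, fun t => ?_, fun T hT => ?_, ?_⟩
      · have h1 := hv t
        have h2 := isOrthogonal_garnirFun (k := k) hlam T₀ (i := i) (U := U) (by omega) t
        calc _ = ∑ g ∈ colStab t, ((Equiv.Perm.sign g : ℤ) : k) * v (g • Tableau.tabloid t) -
              v T₀ * ∑ g ∈ colStab t, ((Equiv.Perm.sign g : ℤ) : k) *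
                garnirFun k T₀ i U (g • Tableau.tabloid t) := by
              rw [mul_sum, ← sum_sub_distrib]
              exact sum_congr rfl fun g _ => by ring
          _ = 0 := by rw [h1, h2, mul_zero, sub_zero]
      · rcases hT.lt_or_eq with hT | rfl
        · have : garnirFun k T₀ i U T = 0 :=
            if_neg fun hm => hT.asymm (hmin T hm hT.ne)
          simp [this, hlow T hT]
        · simp [hself]
      · rw [sum_sub_distrib, ← mul_sum, hg, mul_zero, sub_zero]
  rw [hsum]
  by_cases hne : ({T | T₀ < T} : Finset (Tabloid lam d)).Nonempty
  · obtain ⟨T₁, hT₁, hmin⟩ := exists_min_image _ id hne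
    refine ih T₁ (mem_filter.1 hT₁).2 w hw fun T hT => hwlow T ?_
    by_contra hc
    exact absurd (hmin T (by simpa using hc)) (not_le.2 hT)
  · refine sum_eq_zero fun T _ => hwlow T ?_
    by_contra hc
    exact hne ⟨T, by simpa using hc⟩

/-- The sum of all tabloids. -/
noncomputable def tabloidSum (k : Type u) [Field k] (lam : List ℕ) (d : ℕ) : k[Tabloid lam d] :=
  ∑ T, MonoidAlgebra.single T 1

theorem apply_polytabloid (φ : k[Tabloid lam d] →ₗ[k] k) (t : Tableau lam d) :
    φ (polytabloid k t) = ∑ g ∈ colStab t, ((Equiv.Perm.sign g : ℤ) : k) *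
      φ (MonoidAlgebra.single (g • Tableau.tabloid t) 1) := by
  rw [polytabloid, map_sum]
  refine sum_congr rfl fun g _ => ?_
  rw [← smul_eq_mul, ← map_smul, MonoidAlgebra.smul_single, smul_eq_mul, mul_one]

theorem exists_linearMap_single (v : Tabloid lam d → k) :
    ∃ φ : k[Tabloid lam d] →ₗ[k] k, ∀ T, φ (MonoidAlgebra.single T 1) = v T :=
  ⟨Finsupp.linearCombination k v ∘ₗ (MonoidAlgebra.coeffLinearEquiv k).toLinearMap,
    fun T => by simp⟩

theorem sum_eq_zero_of_tabloidSum_mem (h : tabloidSum k lam d ∈ (spechtSub k lam d).toSubmodule)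
    {v : Tabloid lam d → k} (hv : IsOrthogonal v) : ∑ T, v T = 0 := by
  obtain ⟨φ, hφ⟩ := exists_linearMap_single v
  have hle : (spechtSub k lam d).toSubmodule ≤ LinearMap.ker φ := by
    refine Submodule.span_le.2 ?_
    rintro _ ⟨t, rfl⟩
    simpa [apply_polytabloid, hφ] using hv t
  have := hle h
  rw [LinearMap.mem_ker, tabloidSum, map_sum] at this
  simpa [hφ] using this

/-- The sum of all tabloids lies in the Specht module exactly if the relevant binomial coefficients
vanish. -/
theorem tabloidSum_mem_iff (hlam : IsPartition lam d) :
    tabloidSum k lam d ∈ (spechtSub k lam d).toSubmodule ↔ BinomVanish k lam := by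
  constructor
  · intro h i q hq1 hq
    obtain ⟨T⟩ := nonempty_tabloid hlam.2
    obtain ⟨B, hBs, hB⟩ := exists_subset_card_eq (hq.trans_eq (T.card_row (i + 1)).symm)
    -- This size makes #(B ∪ A) = λ_i + 1, just above the orthogonality bound; q ≥ 1 ensures that
    -- row i has enough entries.
    obtain ⟨A, hAs, hA⟩ := exists_subset_card_eq (s := ({x | T.row x = i} : Finset (Fin d)))
      (n := lam.getD i 0 + 1 - q) (by rw [T.card_row]; omega)
    have hBrow : ∀ x ∈ B, T.row x = i + 1 := fun x hx => (mem_filter.1 (hBs hx)).2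
    have hArow : ∀ x ∈ A, T.row x = i := fun x hx => (mem_filter.1 (hAs hx)).2
    have hU : ∀ x ∈ B ∪ A, T.row x = i ∨ T.row x = i + 1 := by
      intro x hx
      rcases mem_union.1 hx with h | h
      · exact Or.inr (hBrow x h)
      · exact Or.inl (hArow x h)
    have hcard : #(B ∪ A) = lam.getD i 0 + 1 := by
      rw [card_union_of_disjoint, hA, hB]
      · have := getD_succ_le hlam.1 i
        omega
      · refine disjoint_left.2 fun x h h' => ?_
        have := hBrow x h
        have := hArow x h'
        omega
    have hfil : ({x ∈ B ∪ A | T.row x = i + 1} : Finset (Fin d)) = B := by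
      ext x
      simp only [mem_filter, mem_union]
      constructor
      · rintro ⟨h | h, h'⟩
        · exact h
        · have := hArow x h
          omega
      · exact fun h => ⟨Or.inl h, hBrow x h⟩
    have := sum_eq_zero_of_tabloidSum_mem h
      (isOrthogonal_garnirFun (k := k) hlam.1 T (i := i) (U := B ∪ A) (by omega))
    rwa [sum_garnirFun, card_garnirSet hlam.2 hU, hfil, hcard, hB] at this
  · intro hb
    -- Otherwise a linear functional kills the Specht module but not f; its values on tabloids form
    -- an orthogonal function of nonzero sum.
    by_contra hc
    obtain ⟨φ, hφ, hle⟩ := Submodule.exists_le_ker_of_notMem hc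
    refine hφ ?_
    rw [tabloidSum, map_sum]
    refine sum_eq_zero_of_isOrthogonal hlam.1 hlam.2 hb fun t => ?_
    rw [← apply_polytabloid]
    exact hle (Submodule.subset_span ⟨t, rfl⟩)

theorem coeff_tabloidSum (T : Tabloid lam d) : (tabloidSum k lam d).coeff T = 1 := by
  classical
  simp [tabloidSum, MonoidAlgebra.coeff_sum, Finsupp.single_apply]

theorem permRep_tabloidSum (g : Equiv.Perm (Fin d)) :
    permRep k lam d g (tabloidSum k lam d) = tabloidSum k lam d := by
  refine MonoidAlgebra.ext (Finsupp.ext fun T => ?_)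
  rw [Representation.coeff_ofMulAction, coeff_tabloidSum, coeff_tabloidSum]

/-! ### Invariants and H⁰ -/

/-- Transitivity on tabloids makes the coefficients of an invariant vector constant. -/
theorem eq_smul_tabloidSum {v : k[Tabloid lam d]} (hv : ∀ g, permRep k lam d g v = v)
    (T₀ : Tabloid lam d) : v = v.coeff T₀ • tabloidSum k lam d := by
  refine MonoidAlgebra.ext (Finsupp.ext fun T => ?_)
  obtain ⟨g, rfl⟩ := T₀.exists_smul_eq T
  rw [MonoidAlgebra.coeff_smul, Finsupp.smul_apply, coeff_tabloidSum, smul_eq_mul, mul_one]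
  conv_lhs => rw [← hv g]
  rw [Representation.coeff_ofMulAction, inv_smul_smul]

theorem mem_invariants_specht {v : (spechtSub k lam d).toSubmodule} :
    v ∈ (specht k lam d).invariants ↔ ∀ g, permRep k lam d g v = v :=
  forall_congr' fun _ => Subtype.ext_iff

theorem nonempty_invariants_equiv_of_binomVanish (hlam : IsPartition lam d)
    (hb : BinomVanish k lam) : Nonempty (k ≃ₗ[k] (specht k lam d).invariants) := by
  obtain ⟨T₀⟩ := nonempty_tabloid hlam.2
  let f : (specht k lam d).invariants :=
    ⟨⟨tabloidSum k lam d, (tabloidSum_mem_iff hlam).2 hb⟩,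
      mem_invariants_specht.2 permRep_tabloidSum⟩
  refine ⟨LinearEquiv.ofBijective (LinearMap.toSpanSingleton k _ f) ⟨?_, ?_⟩⟩
  · intro c c' h
    have := congrArg (fun w : (specht k lam d).invariants => w.1.1.coeff T₀) h
    simpa [f, coeff_tabloidSum] using this
  · intro w
    exact ⟨w.1.1.coeff T₀, Subtype.ext (Subtype.ext
      (eq_smul_tabloidSum (mem_invariants_specht.1 w.2) T₀).symm)⟩

theorem subsingleton_invariants_of_not_binomVanish (hlam : IsPartition lam d)
    (hb : ¬ BinomVanish k lam) : Subsingleton (specht k lam d).invariants := by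
  obtain ⟨T₀⟩ := nonempty_tabloid hlam.2
  refine subsingleton_of_forall_eq 0 fun w => Subtype.ext (Subtype.ext ?_)
  have h := eq_smul_tabloidSum (mem_invariants_specht.1 w.2) T₀
  have h0 : w.1.1.coeff T₀ = 0 := by
    by_contra hc
    have hmem := w.1.2
    rw [h] at hmem
    exact hb ((tabloidSum_mem_iff hlam).1 (((Submodule.smul_mem_iff _ hc).1 hmem)))
  rw [h, h0, zero_smul]
  rfl

/-- Cohomology in degree zero is the space of invariants. -/
theorem nonempty_cohomology_zero_equiv {G : Type} [Group G] {V : Type u} [AddCommGroup V]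
    [Module k V] (ρ : Representation k G V) :
    Nonempty (cohomology ρ 0 ≃ₗ[k] ρ.invariants) := by
  have h : Representation.invariants
      (ρ.comp (MulEquiv.ulift : ULift.{u} G ≃* G).toMonoidHom) = ρ.invariants := by
    ext v
    exact ⟨fun hv g => hv (ULift.up g), fun hv g => hv g.down⟩
  exact ⟨(groupCohomology.H0Iso _).toLinearEquiv.trans (LinearEquiv.ofEq _ _ h)⟩

theorem nonempty_invariants_equiv {lam' : List ℕ} {d' : ℕ} (hlam : IsPartition lam d)
    (hlam' : IsPartition lam' d') (h : BinomVanish k lam ↔ BinomVanish k lam') :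
    Nonempty ((specht k lam d).invariants ≃ₗ[k] (specht k lam' d').invariants) := by
  by_cases hb : BinomVanish k lam
  · obtain ⟨e⟩ := nonempty_invariants_equiv_of_binomVanish hlam hb
    obtain ⟨e'⟩ := nonempty_invariants_equiv_of_binomVanish hlam' (h.1 hb)
    exact ⟨e.symm.trans e'⟩
  · have := subsingleton_invariants_of_not_binomVanish hlam hb
    have := subsingleton_invariants_of_not_binomVanish hlam' (mt h.2 hb)
    exact ⟨0, 0, fun _ => Subsingleton.elim _ _, fun _ => Subsingleton.elim _ _⟩

/-! ### Divisibility of binomials and the added row -/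

theorem lt_pow_lp {p : ℕ} (hp : 1 < p) (t : ℕ) : t < p ^ lp p t :=
  Nat.sInf_mem (s := {e : ℕ | t < p ^ e}) ⟨t, Nat.lt_pow_self hp⟩

/-- From n · C(n − 1, q − 1) = C(n, q) · q: if p did not divide C(n, q), then p^l would divide q,
which is positive and below p^l. -/
theorem dvd_choose_of_pow_dvd {p l n q : ℕ} (hp : p.Prime) (hn : p ^ l ∣ n) (hq : 1 ≤ q)
    (hql : q < p ^ l) : p ∣ n.choose q := by
  by_contra hc
  obtain ⟨q, rfl⟩ := Nat.exists_eq_add_of_le' hq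
  rcases n with - | n
  · simp at hc
  · have h := Nat.add_one_mul_choose_eq n q
    have hdvd : p ^ l ∣ (n + 1).choose (q + 1) * (q + 1) := h ▸ hn.mul_right _
    have hcop : Nat.Coprime (p ^ l) ((n + 1).choose (q + 1)) :=
      Nat.Coprime.pow_left _ ((Nat.Prime.coprime_iff_not_dvd hp).2 hc)
    exact absurd (Nat.le_of_dvd (Nat.succ_pos _) (hcop.dvd_of_dvd_mul_left hdvd)) (not_le.2 hql)

theorem binomVanish_cons {p : ℕ} [CharP k p] (hp : p.Prime) {a l : ℕ} (ha : p ^ l ∣ a + 1)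
    (hl : lam.headD 0 < p ^ l) : BinomVanish k lam ↔ BinomVanish k (a :: lam) := by
  constructor
  · intro h i q hq1 hq
    rcases i with - | i
    · refine (CharP.cast_eq_zero_iff k p _).2 (dvd_choose_of_pow_dvd hp ha hq1 ?_)
      refine lt_of_le_of_lt hq ?_
      rcases lam with - | ⟨b, lam⟩ <;> exact hl
    · exact h i q hq1 hq
  · exact fun h i q hq1 hq => h (i + 1) q hq1 hq

theorem IsPartition.cons (hlam : IsPartition lam d) {a : ℕ} (ha : lam.headD 0 ≤ a) :
    IsPartition (a :: lam) (d + a) := by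
  refine ⟨?_, by rw [List.sum_cons, hlam.2, add_comm]⟩
  rcases lam with - | ⟨b, lam⟩
  · exact (List.pairwise_singleton _ a).sortedGE
  · have h := hlam.1.pairwise
    refine List.Pairwise.sortedGE (List.pairwise_cons.2 ⟨fun c hc => ?_, h⟩)
    rcases List.mem_cons.1 hc with rfl | hc
    · exact ha
    · exact ((List.pairwise_cons.1 h).1 c hc).trans ha

end SymGrp

/-- `lam.headD 0` is `λ₁` (and `0` for the empty partition of `0`). The first conjunct records
that `(a, λ₁, …, λ_s)` is again a partition. -/
theorem mainTheorem7 {k : Type u} [Field k] (p : ℕ) [Fact p.Prime] [CharP k p]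
    (d a : ℕ) (lam : List ℕ) (hlam : SymGrp.IsPartition lam d)
    (ha : (a : ℤ) ≡ -1 [ZMOD ((p : ℤ) ^ SymGrp.lp p (lam.headD 0))]) :
    SymGrp.IsPartition (a :: lam) (d + a) ∧
      Nonempty (SymGrp.cohomology (SymGrp.specht k lam d) 0 ≃ₗ[k]
        SymGrp.cohomology (SymGrp.specht k (a :: lam) (d + a)) 0) := by
  have hp : p.Prime := Fact.out
  have hl := SymGrp.lt_pow_lp hp.one_lt (lam.headD 0)
  have hdvd : p ^ SymGrp.lp p (lam.headD 0) ∣ a + 1 := by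
    have := ha.symm.dvd
    rw [sub_neg_eq_add] at this
    exact_mod_cast this
  have hcons : SymGrp.IsPartition (a :: lam) (d + a) :=
    -- λ₁ < p^l ≤ a + 1, as p^l divides the positive number a + 1.
    hlam.cons (Nat.lt_succ_iff.1 (hl.trans_le (Nat.le_of_dvd (Nat.succ_pos a) hdvd)))
  obtain ⟨e⟩ := SymGrp.nonempty_cohomology_zero_equiv (SymGrp.specht k lam d)
  obtain ⟨e'⟩ := SymGrp.nonempty_cohomology_zero_equiv (SymGrp.specht k (a :: lam) (d + a))
  obtain ⟨f⟩ := SymGrp.nonempty_invariants_equiv hlam hcons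
    (SymGrp.binomVanish_cons (k := k) hp hdvd hl)
  exact ⟨hcons, ⟨e.trans (f.trans e'.symm)⟩⟩
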